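/- Let $k\ge 2$ be an integer. For every $n\ge 1$ let $C_0^{(n)},\dots,C_{k-1}^{(n)}$ be random complex $n\times n$ matrices, defined on a common probability space, such that all entries of all $C_j^{(n)}$ ($0\le j\le k-1$, $n\ge 1$) are independent and each is a complex normal random variable with mean $0$ and variance $1$ (real and imaginary part are independent real normal variables with mean $0$ and variance $1/2$). Define the $kn\times n$ matrix $E_1$ and the $n\times kn$ matrix $C^T$ by $$E_1=\begin{bmatrix} I_n\\ 0\\ \vdots\\ 0\end{bmatrix},\qquad C^T=-\begin{bmatrix} C_{k-1}^{(n)} & \cdots & C_1^{(n)} & C_0^{(n)}\end{bmatrix},$$ so that $E_1C^T$ is a $kn\times kn$ matrix, and denote by $\sigma_1(A)\ge \sigma_2(A)\ge\dots\ge\sigma_{kn}(A)\ge 0$ the singular values of a $kn\times kn$ matrix $A$. Let $0<\delta<1/2$, let $0\ne z\in\mathbb{C}$, and set $f(n)=\lfloor kn-n^{1-\delta}\rfloor$. Then there exist (deterministic) constants $0<t\le 1$ and $\varepsilon>0$, depending only on $k$, $\delta$ and $z$, such that, almost surely, $$\sigma_{f(n)}\left(n^{-1/2}E_1C^T-zI\right)\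 \ge\ t\,n^{\varepsilon-1/2}\qquad\text{for all sufficiently large } n.$$ -/

import Mathlib

open MeasureTheory ProbabilityTheory Filter

open scoped NNReal

universe u

namespace MonicGaussian

/-- The law of a complex random variable that is normally distributed with mean `0` and
variance `1`: real and imaginary part are independent real normal variables with mean `0`
and variance `1 / 2`. -/
noncomputable def stdComplexGaussian : Measure ℂ :=
  ((gaussianReal 0 (1 / 2 : ℝ≥0)).prod (gaussianReal 0 (1 / 2 : ℝ≥0))).map
    (fun p : ℝ × ℝ => (⟨p.1, p.2⟩ : ℂ))

/-- The `kn × n` block column `E₁ = [I; 0; …; 0]`. A row index `(i, a)` is the `a`-th row of the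
`i`-th block, blocks being counted from `0`. -/
def E₁ (k n : ℕ) : Matrix (Fin k × Fin n) (Fin n) ℂ :=
  Matrix.of fun p b => if (p.1 : ℕ) = 0 then (1 : Matrix (Fin n) (Fin n) ℂ) p.2 b else 0

/-- The `n × kn` block row `Cᵀ = -[C_{k-1} … C_1 C_0]`, for coefficients `C_0, …, C_{k-1}`.
Note `Fin.rev j = k - 1 - j`. -/
def CT {k n : ℕ} (C : Fin k → Matrix (Fin n) (Fin n) ℂ) : Matrix (Fin n) (Fin k × Fin n) ℂ :=
  Matrix.of fun a q => -(C (Fin.rev q.1) a q.2)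

/-- The `i`-th largest singular value `σ_i(A)`, counted from `i = 1` as usual (Mathlib's
sequence of singular values starts at index `0`). The value at `i = 0` has no meaning. -/
noncomputable def sigma {ι : Type*} [Fintype ι] [DecidableEq ι] (i : ℕ) (A : Matrix ι ι ℂ) : ℝ :=
  (Matrix.toEuclideanLin A).singularValues (i - 1)

/-- The index `f(n) = ⌊kn - n^{1-δ}⌋`. For `n ≥ 1`, `k ≥ 2` and `0 < δ < 1` the real number inside
is at least `1`, so the floor with natural values is the usual one. -/
noncomputable def f (k : ℕ) (δ : ℝ) (n : ℕ) : ℕ :=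
  ⌊(k : ℝ) * (n : ℝ) - (n : ℝ) ^ (1 - δ)⌋₊

end MonicGaussian

/-!
After discarding the last `r ≈ n^{1-δ} / 2` columns of the leading `n × n` block of
`M = n^{-1/2} E₁ Cᵀ - z I`, the remaining columns of `M` have, with overwhelming probability, a left
inverse `L` of moderate Hilbert-Schmidt norm. If `L * M` is the identity on a subspace `U`, then
`dim U - i ≤ σ_i(M)² ‖L‖²` with zero-based indexing of the singular values
(`finrank_sub_le_singularValues_sq_mul`: take the trace of `L * M` on the intersection of `U` with
the span of the singular vectors of index at least `i`), and about `n^{1-δ} / 2` dimensions remain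
at the index `f(n)`.

The bottom blocks of `M` are `-z` times the identity, so by block elimination `L` is explicit in a
left inverse `Y` of the selected columns `A` of the leading block and in the products of `Y` with
the other coefficients (`companionLeftInv_mul`). Both are controlled by a union bound
(`gaussianColumns_not_isTypical_le`), conditioning in each case on all columns but one:

* A row of `Y = (Aᴴ A)⁻¹ Aᴴ` has norm the inverse of the distance from a column to the span
  of the other columns (`sum_normSq_leftInv_le`). That span has codimension at least `d = r + 1`, and
  a shifted Gaussian vector lies within `√(d / 2)` of it with probability at most `(√e / 2)^d`
  (`gaussianVector_near_submodule_le`). This follows from `𝔼 exp (-‖Q (X + w)‖²) ≤ 2^{-d}` for an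
  orthogonal projection `Q` of rank `d`, proved by writing the exponential as a characteristic
  function of an independent Gaussian vector and exchanging the two expectations, so that the
  shift `w` becomes a phase.
* `Y` is independent of the columns of the other coefficients, so the product of a row of `Y` with
  such a column exceeds `√T` times the norm of the row with probability of order `exp (-√(T / 2))`
  (`gaussianVector_normSq_gt_le`). The choice `T = n^ε` makes this summable at a cost of `n^ε`
  in `‖L‖²`. No bound on the operator norm of the coefficients is needed.

Together `‖L‖² = O(n^{1+δ+ε})`, hence `σ_{f(n)}(M)² ≥ c n^{-2δ-ε}`; with `ε = (1 - 2δ) / 3` this is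
`c n^{2ε-1}`, and the Borel-Cantelli lemma concludes.
-/

/-! ### Complex Gaussian variables and vectors -/

namespace MonicGaussian

instance isProbabilityMeasure_stdComplexGaussian :
    IsProbabilityMeasure stdComplexGaussian := by
  unfold stdComplexGaussian
  refine Measure.isProbabilityMeasure_map ?_
  exact (Complex.measurableEquivRealProd.symm.measurable).aemeasurable

theorem integral_stdComplexGaussian (F : ℂ → ℂ) :
    ∫ g, F g ∂stdComplexGaussian =
      ∫ p : ℝ × ℝ, F ⟨p.1, p.2⟩
        ∂((gaussianReal 0 (1 / 2 : ℝ≥0)).prod (gaussianReal 0 (1 / 2 : ℝ≥0))) :=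
  integral_map_equiv Complex.measurableEquivRealProd.symm F

theorem integral_cexp_gaussianReal_half (s : ℂ) :
    ∫ x : ℝ, Complex.exp (s * x) ∂(gaussianReal 0 (1 / 2 : ℝ≥0)) = Complex.exp (s ^ 2 / 4) := by
  have h := complexMGF_id_gaussianReal (μ := 0) (v := (1 / 2 : ℝ≥0)) s
  simp only [complexMGF, id] at h
  rw [h]
  congr 1
  push_cast
  ring

theorem integral_cexp_stdComplexGaussian (s t : ℂ) :
    ∫ g : ℂ, Complex.exp (s * g.re + t * g.im) ∂stdComplexGaussian =
      Complex.exp ((s ^ 2 + t ^ 2) / 4) := by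
  rw [integral_stdComplexGaussian]
  simp only [Complex.exp_add]
  rw [integral_prod_mul (fun x : ℝ => Complex.exp (s * x)) (fun x : ℝ => Complex.exp (t * x)),
    integral_cexp_gaussianReal_half, integral_cexp_gaussianReal_half, ← Complex.exp_add]
  congr 1
  ring

theorem integral_exp_neg_sq_gaussianReal_half :
    ∫ x : ℝ, Complex.exp (-(x : ℂ) ^ 2) ∂(gaussianReal 0 (1 / 2 : ℝ≥0)) =
      ((√2)⁻¹ : ℝ) := by
  rw [integral_gaussianReal_eq_integral_smul (by norm_num)]
  have h : ∀ x : ℝ, gaussianPDFReal 0 (1 / 2) x • Complex.exp (-(x : ℂ) ^ 2) =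
      (((√Real.pi)⁻¹ * Real.exp (-2 * x ^ 2) : ℝ) : ℂ) := by
    intro x
    rw [gaussianPDFReal, Complex.real_smul]
    push_cast
    rw [show (2 : ℝ) * Real.pi * (1 / 2) = Real.pi by ring, mul_assoc, ← Complex.exp_add]
    congr 2
    ring
  simp_rw [h]
  rw [integral_complex_ofReal, integral_const_mul, integral_gaussian]
  congr 1
  rw [Real.sqrt_div Real.pi_pos.le]
  have : √Real.pi ≠ 0 := (Real.sqrt_pos.2 Real.pi_pos).ne'
  field_simp

theorem integral_exp_neg_normSq_stdComplexGaussian :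
    ∫ g : ℂ, Complex.exp (-(Complex.normSq g : ℂ)) ∂stdComplexGaussian = 1 / 2 := by
  rw [integral_stdComplexGaussian]
  have h : ∀ p : ℝ × ℝ, Complex.exp (-(Complex.normSq ⟨p.1, p.2⟩ : ℂ)) =
      Complex.exp (-(p.1 : ℂ) ^ 2) * Complex.exp (-(p.2 : ℂ) ^ 2) := by
    intro p
    rw [← Complex.exp_add]
    congr 1
    simp [Complex.normSq_mk]
    ring
  simp_rw [h]
  rw [integral_prod_mul (fun x : ℝ => Complex.exp (-(x : ℂ) ^ 2))
    (fun x : ℝ => Complex.exp (-(x : ℂ) ^ 2)), integral_exp_neg_sq_gaussianReal_half,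
    ← Complex.ofReal_mul, ← mul_inv, Real.mul_self_sqrt (by norm_num)]
  norm_num

/-- The law of a vector of independent standard complex normal variables. -/
noncomputable abbrev gaussianVector (κ : Type*) [Fintype κ] : Measure (κ → ℂ) :=
  Measure.pi fun _ => stdComplexGaussian

variable {κ : Type*} [Fintype κ]

theorem integral_cexp_gaussianVector (s t : κ → ℂ) :
    ∫ x : κ → ℂ, Complex.exp (∑ a, (s a * (x a).re + t a * (x a).im)) ∂gaussianVector κ =
      Complex.exp ((∑ a, (s a ^ 2 + t a ^ 2)) / 4) := by
  simp_rw [Complex.exp_sum]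
  rw [integral_fintype_prod_eq_prod
    (f := fun a (g : ℂ) => Complex.exp (s a * g.re + t a * g.im))]
  simp_rw [integral_cexp_stdComplexGaussian]
  rw [← Complex.exp_sum, Finset.sum_div]

/-- The characteristic function (imaginary `c`) and the moment generating function (real `c`) of
`Re ∑ a, v a * x a`, which is a centred real normal variable of variance `∑ a, |v a|² / 2`. -/
theorem integral_cexp_re_gaussianVector (c : ℂ) (v : κ → ℂ) :
    ∫ x : κ → ℂ, Complex.exp (c * ((∑ a, v a * x a).re : ℝ)) ∂gaussianVector κ =
      Complex.exp (c ^ 2 * (∑ a, Complex.normSq (v a) : ℝ) / 4) := by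
  have h := integral_cexp_gaussianVector (fun a => c * (v a).re) (fun a => -(c * (v a).im))
  convert h using 2
  · ext x
    congr 1
    simp only [Complex.re_sum, Complex.mul_re, Complex.ofReal_sum, Complex.ofReal_sub,
      Complex.ofReal_mul, Finset.mul_sum]
    refine Finset.sum_congr rfl fun a _ => ?_
    ring
  · congr 1
    simp only [Complex.ofReal_sum, Finset.mul_sum, Complex.normSq_apply]
    refine Finset.sum_congr rfl fun a _ => ?_
    push_cast
    ring

end MonicGaussian

/-! ### Small-ball and tail estimates -/

namespace MonicGaussian
variable {κ : Type*} [Fintype κ]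

open scoped ComplexConjugate in
/-- The function `exp (-‖ζ‖²)` is the characteristic function of a Gaussian vector at `2 ζ`. -/
theorem exp_neg_sum_normSq_eq_integral (ζ : κ → ℂ) :
    Complex.exp (-(∑ j, Complex.normSq (ζ j) : ℝ)) =
      ∫ g : κ → ℂ, Complex.exp (2 * Complex.I * ((∑ j, conj (ζ j) * g j).re : ℝ))
        ∂gaussianVector κ := by
  rw [integral_cexp_re_gaussianVector]
  congr 1
  simp only [Complex.normSq_conj, mul_pow, Complex.I_sq]
  ring

theorem integral_exp_neg_sum_normSq_gaussianVector :
    ∫ g : κ → ℂ, Complex.exp (-(∑ j, Complex.normSq (g j) : ℝ)) ∂gaussianVector κ =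
      (1 / 2) ^ Fintype.card κ := by
  have h : ∀ g : κ → ℂ, Complex.exp (-(∑ j, Complex.normSq (g j) : ℝ)) =
      ∏ j, Complex.exp (-(Complex.normSq (g j) : ℂ)) := by
    intro g
    rw [← Complex.exp_sum, Finset.sum_neg_distrib]
    push_cast
    rfl
  simp_rw [h]
  rw [integral_fintype_prod_eq_prod
    (f := fun _ (g : ℂ) => Complex.exp (-(Complex.normSq g : ℂ)))]
  simp [integral_exp_neg_normSq_stdComplexGaussian]

open scoped ComplexConjugate in
/-- The exponential moment of the projection of a shifted Gaussian vector onto the span of an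
orthonormal family. Linearizing the square by `exp_neg_sum_normSq_eq_integral` and
exchanging the integrals turns the shift `w` into a factor of absolute value `1`. -/
theorem norm_integral_exp_neg_sum_normSq_le {ι : Type*} [Fintype ι] [DecidableEq ι]
    (u : ι → κ → ℂ) (hu : ∀ i j, ∑ a, conj (u i a) * u j a = if i = j then 1 else 0)
    (w : κ → ℂ) :
    ‖∫ x : κ → ℂ, Complex.exp
        (-(∑ j, Complex.normSq (∑ a, conj (u j a) * (x a + w a)) : ℝ)) ∂gaussianVector κ‖ ≤
      (1 / 2) ^ Fintype.card ι := by
  have hphase : ∀ (x : κ → ℂ) (g : ι → ℂ),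
      (∑ j, conj (∑ a, conj (u j a) * (x a + w a)) * g j).re =
        (∑ a, conj (∑ j, u j a * g j) * x a).re + (∑ a, conj (∑ j, u j a * g j) * w a).re := by
    intro x g
    rw [← Complex.add_re, ← Finset.sum_add_distrib, ← Complex.conj_re]
    congr 1
    simp only [map_sum, map_mul, map_add, Complex.conj_conj, Finset.sum_mul]
    rw [Finset.sum_comm]
    refine Finset.sum_congr rfl fun a _ => ?_
    rw [← Finset.sum_add_distrib]
    refine Finset.sum_congr rfl fun j _ => ?_
    ring
  have hnorm : ∀ g : ι → ℂ, ∑ a, Complex.normSq (conj (∑ j, u j a * g j)) =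
      ∑ j, Complex.normSq (g j) := by
    intro g
    apply Complex.ofReal_injective
    push_cast
    simp_rw [Complex.normSq_conj]
    simp only [Complex.normSq_eq_conj_mul_self, map_sum, map_mul,
      Finset.sum_mul_sum]
    have h1 : ∀ i j, ∑ a, conj (u i a) * conj (g i) * (u j a * g j) =
        if i = j then conj (g i) * g j else 0 := by
      intro i j
      rw [← mul_one (conj (g i) * g j), ← mul_ite_zero, ← hu i j, Finset.mul_sum]
      exact Finset.sum_congr rfl fun a _ => by ring
    rw [Finset.sum_comm]
    refine Finset.sum_congr rfl fun i _ => ?_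
    rw [Finset.sum_comm]
    simp [h1]
  simp_rw [exp_neg_sum_normSq_eq_integral]
  rw [integral_integral_swap]
  · calc _ ≤ ∫ g : ι → ℂ, Real.exp (-(∑ j, Complex.normSq (g j))) ∂gaussianVector ι := by
          refine norm_integral_le_of_norm_le ?_ (Eventually.of_forall fun g => ?_)
          · refine Integrable.of_bound (C := 1) ?_ (Eventually.of_forall fun g => ?_)
            · have := Complex.continuous_normSq
              have hc : Continuous fun g : ι → ℂ => -∑ j, Complex.normSq (g j) := by fun_prop
              exact (Real.continuous_exp.comp hc).aestronglyMeasurable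
            · rw [Real.norm_eq_abs, Real.abs_exp, Real.exp_le_one_iff, neg_nonpos]
              exact Finset.sum_nonneg fun j _ => Complex.normSq_nonneg _
          · simp_rw [hphase, Complex.ofReal_add, mul_add, Complex.exp_add]
            rw [integral_mul_const, integral_cexp_re_gaussianVector, hnorm, norm_mul,
              Complex.norm_exp, Complex.norm_exp]
            have : ((2 * Complex.I) ^ 2 * ((∑ j, Complex.normSq (g j) : ℝ) : ℂ) / 4).re =
                -(∑ j, Complex.normSq (g j)) := by
              rw [mul_pow, Complex.I_sq, show (2 ^ 2 * -1 * ((∑ j, Complex.normSq (g j) : ℝ) : ℂ)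
                / 4) = ((-(∑ j, Complex.normSq (g j)) : ℝ) : ℂ) by push_cast; ring,
                Complex.ofReal_re]
            rw [this]
            simp
    _ = (1 / 2) ^ Fintype.card ι := by
          apply Complex.ofReal_injective
          rw [← integral_complex_ofReal]
          simp only [Complex.ofReal_exp, Complex.ofReal_neg,
            integral_exp_neg_sum_normSq_gaussianVector]
          push_cast
          rfl
  · refine Integrable.of_bound (C := 1) ?_ (Eventually.of_forall fun p => ?_)
    · refine Continuous.aestronglyMeasurable ?_
      unfold Function.uncurry
      fun_prop
    · simp only [Function.uncurry]
      rw [Complex.norm_exp]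
      simp

open scoped ComplexConjugate in
/-- Markov's inequality for `norm_integral_exp_neg_sum_normSq_le`. -/
theorem gaussianVector_sum_normSq_le {ι : Type*} [Fintype ι] [DecidableEq ι]
    (u : ι → κ → ℂ) (hu : ∀ i j, ∑ a, conj (u i a) * u j a = if i = j then 1 else 0)
    (w : κ → ℂ) :
    gaussianVector κ {x | ∑ j, Complex.normSq (∑ a, conj (u j a) * (x a + w a)) ≤
        Fintype.card ι / 2} ≤
      ENNReal.ofReal ((√(Real.exp 1) / 2) ^ Fintype.card ι) := by
  set F : (κ → ℂ) → ℝ := fun x => ∑ j, Complex.normSq (∑ a, conj (u j a) * (x a + w a)) with hF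
  have hF0 : ∀ x, 0 ≤ F x := fun x => Finset.sum_nonneg fun j _ => Complex.normSq_nonneg _
  have hFc : Continuous F := by
    rw [hF]
    have := Complex.continuous_normSq
    fun_prop
  have hint : Integrable (fun x => Real.exp (-F x)) (gaussianVector κ) := by
    refine Integrable.of_bound (C := 1) ?_ (Eventually.of_forall fun g => ?_)
    · exact (Real.continuous_exp.comp hFc.neg).aestronglyMeasurable
    · rw [Real.norm_eq_abs, Real.abs_exp, Real.exp_le_one_iff, neg_nonpos]
      exact hF0 g
  have hle : ∫ x, Real.exp (-F x) ∂gaussianVector κ ≤ (1 / 2) ^ Fintype.card ι := by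
    have h := norm_integral_exp_neg_sum_normSq_le u hu w
    simp only [← Complex.ofReal_neg, ← Complex.ofReal_exp] at h
    rw [integral_complex_ofReal, Complex.norm_real] at h
    exact (le_abs_self _).trans h
  have hM := mul_meas_ge_le_integral_of_nonneg
    (Eventually.of_forall fun x => (Real.exp_pos (-F x)).le) hint
    (Real.exp (-(Fintype.card ι / 2 : ℝ)))
  have hset : {x | Real.exp (-(Fintype.card ι / 2 : ℝ)) ≤ Real.exp (-F x)} =
      {x | F x ≤ Fintype.card ι / 2} := by
    ext x
    simp
  rw [hset] at hM
  rw [← ofReal_measureReal]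
  refine ENNReal.ofReal_le_ofReal ?_
  have hpos := Real.exp_pos (-(Fintype.card ι / 2 : ℝ))
  rw [mul_comm, ← le_div_iff₀ hpos] at hM
  refine hM.trans ?_
  rw [div_le_iff₀ hpos]
  refine hle.trans (le_of_eq ?_)
  have : Real.exp (-(Fintype.card ι / 2 : ℝ)) = ((√(Real.exp 1))⁻¹) ^ Fintype.card ι := by
    rw [← Real.exp_half, ← Real.exp_neg, ← Real.exp_nat_mul]
    congr 1
    ring
  rw [this, ← mul_pow]
  congr 1
  have : √(Real.exp 1) ≠ 0 := (Real.sqrt_pos.2 (Real.exp_pos 1)).ne'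
  field_simp

theorem sqrt_exp_one_div_two_lt_one : √(Real.exp 1) / 2 < 1 := by
  rw [div_lt_one (by norm_num), Real.sqrt_lt' (by norm_num)]
  exact Real.exp_one_lt_d9.trans (by norm_num)

/-- Small-ball estimate: a shifted Gaussian vector is unlikely to be within `√(d / 2)` of a fixed
subspace of codimension at least `d`. -/
theorem gaussianVector_near_submodule_le (H : Submodule ℂ (EuclideanSpace ℂ κ))
    (w : EuclideanSpace ℂ κ) (d : ℕ) (hd : d + Module.finrank ℂ H ≤ Fintype.card κ) :
    gaussianVector κ {x | ∃ h ∈ H, ‖WithLp.toLp 2 x + w - h‖ ^ 2 ≤ d / 2} ≤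
      ENNReal.ofReal ((√(Real.exp 1) / 2) ^ d) := by
  classical
  set u := stdOrthonormalBasis ℂ Hᗮ with hu
  have hD : Module.finrank ℂ H + Module.finrank ℂ Hᗮ = Fintype.card κ := by
    rw [H.finrank_add_finrank_orthogonal, finrank_euclideanSpace]
  have hdD : d ≤ Module.finrank ℂ Hᗮ := by omega
  have huo : Orthonormal ℂ (fun i => (u i : EuclideanSpace ℂ κ)) :=
    u.orthonormal.comp_linearIsometry Hᗮ.subtypeₗᵢ
  refine (measure_mono ?_).trans ((gaussianVector_sum_normSq_le
    (fun j a => (u j : EuclideanSpace ℂ κ) a) (fun i j => ?_) w).trans ?_)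
  · rintro x ⟨h, hH, hx⟩
    simp only [Set.mem_ofPred_eq, Fintype.card_fin]
    have key : ∀ j, ∑ a, (starRingEnd ℂ) ((u j : EuclideanSpace ℂ κ) a) * (x a + w a) =
        inner ℂ (u j : EuclideanSpace ℂ κ) (WithLp.toLp 2 x + w - h) := by
      intro j
      rw [inner_sub_right, Submodule.inner_left_of_mem_orthogonal hH (u j).2, sub_zero]
      simp [PiLp.inner_apply, mul_comm]
    simp_rw [key, Complex.normSq_eq_norm_sq]
    refine (huo.sum_inner_products_le _).trans (hx.trans ?_)
    gcongr
  · have := orthonormal_iff_ite.1 huo i j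
    rw [← this]
    simp [PiLp.inner_apply, mul_comm]
  · refine ENNReal.ofReal_le_ofReal ?_
    rw [Fintype.card_fin]
    exact pow_le_pow_of_le_one (by positivity) sqrt_exp_one_div_two_lt_one.le hdD

/-- Markov's inequality for the exponential moment of the real part divided by
`√(∑ a, |v a|²)`. -/
theorem gaussianVector_real_re_ge_le (v : κ → ℂ) (hv : 0 < ∑ a, Complex.normSq (v a)) (s : ℝ) :
    (gaussianVector κ).real {x | s * √(∑ a, Complex.normSq (v a)) ≤ (∑ a, v a * x a).re} ≤
      Real.exp (1 / 4 - s) := by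
  set V := ∑ a, Complex.normSq (v a) with hV
  have hV0 : 0 < √V := Real.sqrt_pos.2 hv
  set F : (κ → ℂ) → ℝ := fun x => (∑ a, v a * x a).re with hF
  have hmgf : ∫ x, Real.exp ((√V)⁻¹ * F x) ∂gaussianVector κ = Real.exp (1 / 4) := by
    have h := integral_cexp_re_gaussianVector (κ := κ) ((√V)⁻¹ : ℝ) v
    apply Complex.ofReal_injective
    rw [← integral_complex_ofReal]
    simp only [Complex.ofReal_exp, Complex.ofReal_mul]
    rw [h, ← hV, ← Complex.ofReal_pow, ← Complex.ofReal_mul, inv_pow, Real.sq_sqrt hv.le,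
      inv_mul_cancel₀ hv.ne']
    simp
  have hint : Integrable (fun x => Real.exp ((√V)⁻¹ * F x)) (gaussianVector κ) :=
    Integrable.of_integral_ne_zero (by rw [hmgf]; exact (Real.exp_pos _).ne')
  have h := measure_ge_le_exp_mul_mgf (μ := gaussianVector κ) (X := F) (s * √V)
    (inv_pos.2 hV0).le hint
  refine h.trans (le_of_eq ?_)
  rw [mgf, hmgf, ← Real.exp_add]
  congr 1
  field_simp
  ring

/-- If `|ζ|² > T`, then one of the four numbers `±Re ζ`, `±Im ζ` is at least `√(T / 2)`, which
reduces the tail of the complex variable `∑ a, y a * x a` to that of four real parts. -/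
theorem gaussianVector_normSq_gt_le (y : κ → ℂ) (T : ℝ) (hT : 0 ≤ T) :
    gaussianVector κ {x | T * ∑ a, Complex.normSq (y a) < Complex.normSq (∑ a, y a * x a)} ≤
      ENNReal.ofReal (4 * Real.exp (1 / 4 - √(T / 2))) := by
  rcases (Finset.sum_nonneg fun a _ => Complex.normSq_nonneg (y a) :
    0 ≤ ∑ a, Complex.normSq (y a)).eq_or_lt with h0 | h0
  · have hy : ∀ a, y a = 0 := fun a => Complex.normSq_eq_zero.1
      ((Finset.sum_eq_zero_iff_of_nonneg fun a _ => Complex.normSq_nonneg (y a)).1 h0.symm a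
        (Finset.mem_univ a))
    simp [hy]
  set Y := ∑ a, Complex.normSq (y a) with hY
  set B : ℂ → Set (κ → ℂ) := fun α =>
    {x | √(T / 2) * √(∑ a, Complex.normSq (α * y a)) ≤ (∑ a, α * y a * x a).re} with hB
  have hBle : ∀ α : ℂ, Complex.normSq α = 1 →
      (gaussianVector κ).real (B α) ≤ Real.exp (1 / 4 - √(T / 2)) := by
    intro α hα
    refine gaussianVector_real_re_ge_le (fun a => α * y a) ?_ _
    simpa [hα] using h0
  have hsub : {x : κ → ℂ | T * Y < Complex.normSq (∑ a, y a * x a)} ⊆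
      (B 1 ∪ B (-1)) ∪ (B Complex.I ∪ B (-Complex.I)) := by
    intro x hx
    have hx' : T * Y < Complex.normSq (∑ a, y a * x a) := hx
    by_contra hcon
    simp only [hB, Set.mem_union, Set.mem_ofPred_eq, not_or, not_le, mul_assoc,
      ← Finset.mul_sum, Complex.normSq_mul] at hcon
    obtain ⟨⟨h1, h2⟩, h3, h4⟩ := hcon
    simp only [Complex.normSq_one, Complex.normSq_neg, Complex.normSq_I, one_mul, ← hY,
      Complex.neg_re, neg_mul, Complex.I_mul_re, neg_neg] at h1 h2 h3 h4
    set ζ := ∑ a, y a * x a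
    have hR : (√(T / 2) * √Y) ^ 2 = T / 2 * Y := by
      rw [mul_pow, Real.sq_sqrt (by positivity), Real.sq_sqrt h0.le]
    have hre : ζ.re ^ 2 < (√(T / 2) * √Y) ^ 2 := sq_lt_sq' (by linarith) h1
    have him : ζ.im ^ 2 < (√(T / 2) * √Y) ^ 2 := sq_lt_sq' (by linarith) h4
    rw [Complex.normSq_apply] at hx'
    nlinarith
  refine (measure_mono hsub).trans ?_
  rw [← ofReal_measureReal]
  refine ENNReal.ofReal_le_ofReal ?_
  have hI := hBle Complex.I (by simp)
  have hI' := hBle (-Complex.I) (by simp)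
  have h1 := hBle 1 (by simp)
  have h1' := hBle (-1) (by simp)
  have hu := measureReal_union_le (μ := gaussianVector κ) (B 1 ∪ B (-1))
    (B Complex.I ∪ B (-Complex.I))
  have hu1 := measureReal_union_le (μ := gaussianVector κ) (B 1) (B (-1))
  have hu2 := measureReal_union_le (μ := gaussianVector κ) (B Complex.I) (B (-Complex.I))
  linarith

/-- A bound that holds for every section in one coordinate holds for the product measure. -/
theorem pi_le_of_forall_update_le {ι X : Type*} [Fintype ι] [DecidableEq ι] [MeasurableSpace X]
    (μ : Measure X) [IsProbabilityMeasure μ] (i : ι) (E : Set (ι → X)) (hE : MeasurableSet E)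
    (p : ENNReal) (h : ∀ x : ι → X, μ {v | Function.update x i v ∈ E} ≤ p) :
    Measure.pi (fun _ : ι => μ) E ≤ p := by
  rw [← lintegral_indicator_one hE]
  refine (lintegral_le_of_lmarginal_le {i} (g := fun _ => p) ?_ ?_ ?_).trans ?_
  · exact measurable_one.indicator hE
  · exact measurable_const
  · intro x
    simp only [lmarginal_singleton]
    refine le_trans (le_of_eq ?_) ((h x).trans (by simp))
    have hm : MeasurableSet {v | Function.update x i v ∈ E} := measurable_update x hE
    rw [← lintegral_indicator_one hm]
    rfl
  · simp
end MonicGaussian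

/-! ### Singular values and left inverses -/

namespace MonicGaussian

/-- The subspace is the span of the right singular vectors of index at least `i`. -/
theorem exists_submodule_norm_le_singularValues {E : Type*} [NormedAddCommGroup E]
    [InnerProductSpace ℂ E] [FiniteDimensional ℂ E] (T : E →ₗ[ℂ] E) (i : ℕ)
    (hi : i < Module.finrank ℂ E) :
    ∃ V : Submodule ℂ E, Module.finrank ℂ V + i = Module.finrank ℂ E ∧
      ∀ v ∈ V, ‖T v‖ ≤ T.singularValues i * ‖v‖ := by
  classical
  set b := T.isSymmetric_adjoint_comp_self.eigenvectorBasis rfl with hb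
  set J : Finset (Fin (Module.finrank ℂ E)) := Finset.univ.filter fun j => i ≤ j.val with hJ
  have hJc : J.card + i = Module.finrank ℂ E := by
    have h1 : J = Finset.Ici ⟨i, hi⟩ := by
      ext j; simp [hJ, Fin.le_def]
    rw [h1, Fin.card_Ici]
    simp only
    omega
  have hli : LinearIndependent ℂ fun j : J => b j :=
    (b.orthonormal.comp (fun j : J => j.1) Subtype.val_injective).linearIndependent
  refine ⟨Submodule.span ℂ (Set.range fun j : J => b j), ?_, ?_⟩
  · rw [finrank_span_eq_card hli, Fintype.card_coe, hJc]
  intro v hv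
  have hzero : ∀ j, j ∉ J → inner ℂ (b j) v = 0 := by
    intro j hj
    refine Submodule.span_induction (p := fun w _ => inner ℂ (b j) w = 0) ?_ ?_ ?_ ?_ hv
    · rintro _ ⟨l, rfl⟩
      have : j ≠ l := fun h => hj (h ▸ l.2)
      simp [this]
    · simp
    · intro x y _ _ hx hy
      rw [inner_add_right, hx, hy, add_zero]
    · intro c x _ hx
      rw [inner_smul_right, hx, mul_zero]
  have hT : ‖T v‖ ^ 2 =
      ∑ j : Fin (Module.finrank ℂ E), T.singularValues j ^ 2 * ‖inner ℂ (b j) v‖ ^ 2 := by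
    have h1 : (inner ℂ v ((LinearMap.adjoint T ∘ₗ T) v) : ℂ) = ((‖T v‖ ^ 2 : ℝ) : ℂ) := by
      rw [LinearMap.comp_apply, LinearMap.adjoint_inner_right, inner_self_eq_norm_sq_to_K]
      simp
    apply Complex.ofReal_injective
    rw [← h1, ← b.sum_inner_mul_inner, Complex.ofReal_sum]
    refine Finset.sum_congr rfl fun j _ => ?_
    have h2 : inner ℂ (b j) ((LinearMap.adjoint T ∘ₗ T) v) =
        ((T.singularValues j ^ 2 : ℝ) : ℂ) * inner ℂ (b j) v := by
      rw [← T.isSymmetric_adjoint_comp_self (b j) v,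
        T.isSymmetric_adjoint_comp_self.apply_eigenvectorBasis rfl j, inner_smul_left,
        T.sq_singularValues_fin rfl j]
      simp [hb]
    rw [h2, ← inner_conj_symm v (b j), mul_left_comm, Complex.conj_mul']
    push_cast
    rfl
  have hs := T.singularValues_nonneg i
  refine (abs_le_of_sq_le_sq' ?_ (mul_nonneg hs (norm_nonneg v))).2
  rw [hT, mul_pow, ← b.sum_sq_norm_inner_right v, Finset.mul_sum]
  refine Finset.sum_le_sum fun j _ => ?_
  by_cases hj : j ∈ J
  · have hij : i ≤ j := by simpa [hJ] using hj
    have := T.singularValues_antitone hij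
    have h0 := T.singularValues_nonneg j
    gcongr
  · simp [hzero j hj]

/-- If `L` is a left inverse of `M` on a subspace `U`, then the Hilbert-Schmidt norm of `L` controls
the singular values of `M` from below: with `V` the span of the singular vectors of index at least
`i`, take the trace of `L * M` over an orthonormal basis of `U ⊓ V`. -/
theorem finrank_sub_le_singularValues_sq_mul {ι : Type*} [Fintype ι] [DecidableEq ι]
    (M L : Matrix ι ι ℂ) (U : Submodule ℂ (EuclideanSpace ℂ ι))
    (hL : ∀ v ∈ U, ∀ p, v p = ∑ q, L p q * (Matrix.toEuclideanLin M v) q) (i : ℕ)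
    (hi : i < Fintype.card ι) :
    (Module.finrank ℂ U : ℝ) - i ≤
      (Matrix.toEuclideanLin M).singularValues i ^ 2 * ∑ p, ∑ q, Complex.normSq (L p q) := by
  set T := Matrix.toEuclideanLin M with hT
  set σ := T.singularValues i with hσ
  have hσ0 : 0 ≤ σ := T.singularValues_nonneg i
  set K := ∑ p, ∑ q, Complex.normSq (L p q) with hK
  have hK0 : 0 ≤ K := Finset.sum_nonneg fun p _ => Finset.sum_nonneg fun q _ =>
    Complex.normSq_nonneg _
  obtain ⟨V, hV, hVT⟩ := exists_submodule_norm_le_singularValues T i (by simpa using hi)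
  set W := U ⊓ V with hW
  have hdim : (Module.finrank ℂ U : ℝ) - i ≤ Module.finrank ℂ W := by
    have h1 := Submodule.finrank_sup_add_finrank_inf_eq U V
    have h2 := Submodule.finrank_le (U ⊔ V)
    have h3 : Module.finrank ℂ U ≤ i + Module.finrank ℂ W := by
      rw [hW]; omega
    have : (Module.finrank ℂ U : ℝ) ≤ i + Module.finrank ℂ W := by exact_mod_cast h3
    linarith
  refine hdim.trans ?_
  set d := Module.finrank ℂ W with hd
  set u := stdOrthonormalBasis ℂ W with hu
  have huo : Orthonormal ℂ (fun j => (u j : EuclideanSpace ℂ ι)) :=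
    u.orthonormal.comp_linearIsometry W.subtypeₗᵢ
  have huU : ∀ j, (u j : EuclideanSpace ℂ ι) ∈ U := fun j => (u j).2.1
  have huT : ∀ j, ‖T (u j)‖ ≤ σ := by
    intro j
    have := hVT _ (u j).2.2
    rwa [huo.1 j, mul_one] at this
  -- `g j` is the row vector `(u j)ᴴ * L`
  set g : Fin d → ι → ℂ := fun j q => ∑ p, (starRingEnd ℂ) ((u j : EuclideanSpace ℂ ι) p) * L p q
    with hg
  have hone : ∀ j, (1 : ℂ) = ∑ q, g j q * (T (u j)) q := by
    intro j
    have h1 : inner ℂ (u j : EuclideanSpace ℂ ι) (u j : EuclideanSpace ℂ ι) = (1 : ℂ) := by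
      rw [inner_self_eq_norm_sq_to_K, huo.1 j]; simp
    rw [← h1, PiLp.inner_apply]
    simp only [hg, Finset.sum_mul]
    rw [Finset.sum_comm]
    refine Finset.sum_congr rfl fun p _ => ?_
    simp only [mul_assoc]
    rw [RCLike.inner_apply, mul_comm, ← Finset.mul_sum, ← hL _ (huU j) p]
  have hgK : ∑ j, ∑ q, ‖g j q‖ ^ 2 ≤ K := by
    rw [hK, Finset.sum_comm (f := fun p q => Complex.normSq (L p q)), Finset.sum_comm]
    refine Finset.sum_le_sum fun q _ => ?_
    have h := huo.sum_inner_products_le (s := Finset.univ) (WithLp.toLp 2 fun p => L p q)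
    rw [EuclideanSpace.norm_sq_eq] at h
    refine le_trans (le_of_eq (Finset.sum_congr rfl fun j _ => ?_)) (h.trans (le_of_eq ?_))
    · simp [hg, PiLp.inner_apply, mul_comm]
    · exact Finset.sum_congr rfl fun p _ => (Complex.normSq_eq_norm_sq _).symm
  have hj : ∀ j, 1 ≤ σ ^ 2 * ∑ q, ‖g j q‖ ^ 2 := by
    intro j
    have h1 : (1 : ℝ) ≤ ∑ q, ‖g j q‖ * ‖(T (u j)) q‖ := by
      calc (1 : ℝ) = ‖∑ q, g j q * (T (u j)) q‖ := by rw [← hone j, norm_one]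
        _ ≤ _ := (norm_sum_le _ _).trans (le_of_eq (by simp))
    have h2 := Finset.sum_mul_sq_le_sq_mul_sq Finset.univ (fun q => ‖g j q‖)
      (fun q => ‖(T (u j)) q‖)
    rw [← EuclideanSpace.norm_sq_eq] at h2
    have h3 : ‖T (u j)‖ ^ 2 ≤ σ ^ 2 := by
      have := huT j
      gcongr
    have h4 : (0 : ℝ) ≤ ∑ q, ‖g j q‖ ^ 2 := by positivity
    nlinarith
  calc (d : ℝ) = ∑ _j : Fin d, (1 : ℝ) := by simp
    _ ≤ ∑ j, σ ^ 2 * ∑ q, ‖g j q‖ ^ 2 := Finset.sum_le_sum fun j _ => hj j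
    _ ≤ σ ^ 2 * K := by
        rw [← Finset.mul_sum]
        gcongr

/-- The Moore-Penrose left inverse `(Aᴴ A)⁻¹ Aᴴ` of a matrix with linearly independent columns. -/
noncomputable def leftInv {m s : Type*} [Fintype m] [Fintype s] [DecidableEq s]
    (A : Matrix m s ℂ) : Matrix s m ℂ :=
  (A.conjTranspose * A)⁻¹ * A.conjTranspose

section LeftInv
variable {m s : Type*} [Fintype m] [Fintype s] [DecidableEq s]
open scoped Matrix ComplexConjugate ComplexOrder

omit [DecidableEq s] in
theorem sum_normSq_mulVec_smul (A : Matrix m s ℂ) (c : s → ℂ) (e : ℂ) :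
    ∑ a, Complex.normSq ((A *ᵥ (e • c)) a) =
      Complex.normSq e * ∑ a, Complex.normSq ((A *ᵥ c) a) := by
  rw [Matrix.mulVec_smul, Finset.mul_sum]
  simp

/-- The hypothesis says that each column of `A` is at distance at least `√τ` from the span of the
others; in particular the columns are linearly independent. -/
theorem isUnit_det_conjTranspose_mul_self (A : Matrix m s ℂ) (τ : ℝ) (hτ : 0 < τ)
    (h : ∀ (i : s) (c : s → ℂ), c i = 1 → τ ≤ ∑ a, Complex.normSq ((A *ᵥ c) a)) :
    IsUnit (Aᴴ * A).det := by
  rw [← Matrix.isUnit_iff_isUnit_det, ← Matrix.mulVec_injective_iff_isUnit,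
    ← Matrix.coe_mulVecLin, injective_iff_map_eq_zero (Matrix.mulVecLin (Aᴴ * A))]
  intro c hc
  by_contra hne
  obtain ⟨i, hi⟩ := Function.ne_iff.1 hne
  have hA : A *ᵥ c = 0 := by
    have : Aᴴ *ᵥ (A *ᵥ c) = 0 := by rw [Matrix.mulVec_mulVec]; exact hc
    exact (Matrix.conjTranspose_mul_self_mulVec_eq_zero A c).1 hc
  have := h i ((c i)⁻¹ • c) (by simp [inv_mul_cancel₀ (show c i ≠ 0 from hi)])
  rw [sum_normSq_mulVec_smul, hA] at this
  simp at this
  linarith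

theorem leftInv_mul_self (A : Matrix m s ℂ) (τ : ℝ) (hτ : 0 < τ)
    (h : ∀ (i : s) (c : s → ℂ), c i = 1 → τ ≤ ∑ a, Complex.normSq ((A *ᵥ c) a)) :
    leftInv A * A = 1 := by
  rw [leftInv, Matrix.mul_assoc,
    Matrix.nonsing_inv_mul _ (isUnit_det_conjTranspose_mul_self A τ hτ h)]

/-- The `i`-th row of the left inverse has norm the inverse of the distance from the `i`-th column to
the span of the others. With `G = (Aᴴ A)⁻¹`, its conjugate is `A` applied to the `i`-th column of
`G`, and its squared norm is `G i i`, so dividing by `G i i` gives an admissible vector `c`. -/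
theorem sum_normSq_leftInv_le (A : Matrix m s ℂ) (τ : ℝ) (hτ : 0 < τ)
    (h : ∀ (i : s) (c : s → ℂ), c i = 1 → τ ≤ ∑ a, Complex.normSq ((A *ᵥ c) a)) (i : s) :
    ∑ a, Complex.normSq (leftInv A i a) ≤ 1 / τ := by
  set G := (Aᴴ * A)⁻¹ with hG
  have hu := isUnit_det_conjTranspose_mul_self A τ hτ h
  have hGH : Gᴴ = G := by
    rw [hG, Matrix.conjTranspose_nonsing_inv, Matrix.conjTranspose_mul,
      Matrix.conjTranspose_conjTranspose]
  have hR : ∀ a, conj (leftInv A i a) = (A *ᵥ (fun l => G l i)) a := by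
    intro a
    have : conj (leftInv A i a) = (leftInv A)ᴴ a i := rfl
    rw [this, leftInv, ← hG, Matrix.conjTranspose_mul, Matrix.conjTranspose_conjTranspose, hGH]
    rfl
  set ρ := ∑ a, Complex.normSq (leftInv A i a) with hρ
  have hρG : (ρ : ℂ) = G i i := by
    have h1 : (leftInv A * (leftInv A)ᴴ) i i = (ρ : ℂ) := by
      rw [Matrix.mul_apply, hρ]
      push_cast
      exact Finset.sum_congr rfl fun a _ => (Complex.mul_conj _)
    rw [← h1, leftInv, ← hG, Matrix.conjTranspose_mul, Matrix.conjTranspose_conjTranspose, hGH,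
      Matrix.mul_assoc, ← Matrix.mul_assoc Aᴴ, hG, Matrix.mul_nonsing_inv _ hu, Matrix.mul_one]
  have hρ0 : 0 ≤ ρ := Finset.sum_nonneg fun a _ => Complex.normSq_nonneg _
  rcases hρ0.eq_or_lt with h0 | h0
  · rw [← h0]; positivity
  have h2 := h i ((ρ : ℂ)⁻¹ • fun l => G l i) (by
    simp [← hρG, h0.ne'])
  have h3 : ∑ a, Complex.normSq ((A *ᵥ fun l => G l i) a) = ρ := by
    rw [hρ]
    exact Finset.sum_congr rfl fun a _ => by rw [← hR, Complex.normSq_conj]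
  rw [sum_normSq_mulVec_smul, h3, Complex.normSq_inv, Complex.normSq_ofReal] at h2
  rw [le_div_iff₀ hτ]
  rw [mul_inv, mul_assoc, inv_mul_cancel₀ h0.ne', mul_one] at h2
  calc ρ * τ ≤ ρ * ρ⁻¹ := by gcongr
    _ = 1 := mul_inv_cancel₀ h0.ne'

theorem measurable_leftInv_apply {X : Type*} [TopologicalSpace X] [MeasurableSpace X]
    [OpensMeasurableSpace X] (A : X → Matrix m s ℂ) (hA : Continuous A) (i : s) (a : m) :
    Measurable fun x => leftInv (A x) i a := by
  have h1 : Continuous fun x => (A x)ᴴ * A x := hA.matrix_conjTranspose.matrix_mul hA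
  have h2 : ∀ x, leftInv (A x) i a =
      ((A x)ᴴ * A x).det⁻¹ * (((A x)ᴴ * A x).adjugate * (A x)ᴴ) i a := by
    intro x
    rw [leftInv, Matrix.inv_def, Ring.inverse_eq_inv, Matrix.smul_mul, Matrix.smul_apply,
      smul_eq_mul]
  simp_rw [h2]
  refine h1.matrix_det.measurable.inv.mul (Continuous.measurable ?_)
  exact (h1.matrix_adjugate.matrix_mul hA.matrix_conjTranspose).matrix_elem i a
end LeftInv
end MonicGaussian

/-! ### Typical columns -/

namespace MonicGaussian

section Columns
variable {ι κ s : Type*}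
open scoped Matrix

/-- The matrix whose columns are the vectors `x (e i) + w i`: selected random columns plus
deterministic shifts. -/
def shiftedColumns (e : s → ι) (w : s → κ → ℂ) (x : ι → κ → ℂ) : Matrix κ s ℂ :=
  Matrix.of fun a i => x (e i) a + w i a

theorem continuous_shiftedColumns (e : s → ι) (w : s → κ → ℂ) :
    Continuous (shiftedColumns (κ := κ) e w) := by
  refine continuous_matrix fun a i => ?_
  simp only [shiftedColumns, Matrix.of_apply]
  fun_prop

variable [Fintype ι] [DecidableEq ι] [Fintype κ] [Fintype s] [DecidableEq s]

/-- The law of a family of independent standard complex normal vectors. -/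
noncomputable abbrev gaussianColumns (ι κ : Type*) [Fintype ι] [Fintype κ] :
    Measure (ι → κ → ℂ) :=
  Measure.pi fun _ => gaussianVector κ

omit [Fintype ι] [Fintype κ] [Fintype s] [DecidableEq s] in
theorem shiftedColumns_update_of_notMem (e : s → ι) (w : s → κ → ℂ) (x : ι → κ → ℂ) (q : ι)
    (hq : ∀ i, e i ≠ q) (v : κ → ℂ) :
    shiftedColumns e w (Function.update x q v) = shiftedColumns e w x := by
  ext a i
  simp [shiftedColumns, Function.update_of_ne (hq i)]

omit [Fintype ι] [Fintype κ] in
theorem shiftedColumns_mulVec_update (e : s → ι) (he : Function.Injective e) (w : s → κ → ℂ)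
    (x : ι → κ → ℂ) (i : s) (v : κ → ℂ) (c : s → ℂ) (hc : c i = 1) (a : κ) :
    (shiftedColumns e w (Function.update x (e i) v) *ᵥ c) a =
      v a + w i a + ∑ l ∈ Finset.univ.erase i, c l * shiftedColumns e w x a l := by
  rw [Matrix.mulVec, dotProduct, ← Finset.add_sum_erase _ _ (Finset.mem_univ i), hc, mul_one]
  congr 1
  · simp [shiftedColumns]
  · refine Finset.sum_congr rfl fun l hl => ?_
    have : e l ≠ e i := fun h => Finset.ne_of_mem_erase hl (he h)
    simp [shiftedColumns, Function.update_of_ne this, mul_comm]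

/-- The `i`-th of the shifted columns is rarely close to the span of the others: conditionally on
the others, that span is a fixed subspace of codimension at least `d`. -/
theorem gaussianColumns_near_span_le (e : s → ι) (he : Function.Injective e) (w : s → κ → ℂ)
    (d : ℕ) (hd : d + Fintype.card s ≤ Fintype.card κ + 1) (i : s) :
    gaussianColumns ι κ {x | ∃ c : s → ℂ, c i = 1 ∧
        ∑ a, Complex.normSq ((shiftedColumns e w x *ᵥ c) a) < d / 2} ≤
      ENNReal.ofReal ((√(Real.exp 1) / 2) ^ d) := by
  -- an arbitrary union over `c` of open sets, hence measurable
  have hopen : IsOpen {x : ι → κ → ℂ | ∃ c : s → ℂ, c i = 1 ∧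
      ∑ a, Complex.normSq ((shiftedColumns e w x *ᵥ c) a) < d / 2} := by
    have : {x : ι → κ → ℂ | ∃ c : s → ℂ, c i = 1 ∧
        ∑ a, Complex.normSq ((shiftedColumns e w x *ᵥ c) a) < d / 2} =
        ⋃ c ∈ {c : s → ℂ | c i = 1},
          {x | ∑ a, Complex.normSq ((shiftedColumns e w x *ᵥ c) a) < d / 2} := by
      ext x; simp
    rw [this]
    refine isOpen_biUnion fun c _ => isOpen_lt ?_ continuous_const
    refine continuous_finsetSum _ fun a _ => Complex.continuous_normSq.comp ?_
    exact (continuous_apply a).comp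
      ((continuous_shiftedColumns e w).matrix_mulVec continuous_const)
  refine pi_le_of_forall_update_le _ (e i) _ hopen.measurableSet _ fun x => ?_
  classical
  set H : Submodule ℂ (EuclideanSpace ℂ κ) := Submodule.span ℂ
    ((Finset.univ.erase i).image fun l => WithLp.toLp 2 fun a => shiftedColumns e w x a l) with hH
  have hfin : Module.finrank ℂ H + 1 ≤ Fintype.card s := by
    have h1 : Module.finrank ℂ H ≤ _ := finrank_span_finset_le_card _
    have h2 := h1.trans Finset.card_image_le
    rw [Finset.card_erase_of_mem (Finset.mem_univ i), Finset.card_univ] at h2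
    have : 0 < Fintype.card s := Fintype.card_pos_iff.2 ⟨i⟩
    omega
  refine (measure_mono ?_).trans
    (gaussianVector_near_submodule_le H (WithLp.toLp 2 (w i)) d (by omega))
  rintro v ⟨c, hc, hv⟩
  refine ⟨-∑ l ∈ Finset.univ.erase i, c l • WithLp.toLp 2 fun a => shiftedColumns e w x a l,
    ?_, ?_⟩
  · refine H.neg_mem (H.sum_mem fun l hl => H.smul_mem _ (Submodule.subset_span ?_))
    exact Finset.mem_coe.2 (Finset.mem_image_of_mem _ hl)
  · refine le_trans (le_of_eq ?_) hv.le
    rw [EuclideanSpace.norm_sq_eq]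
    refine Finset.sum_congr rfl fun a _ => ?_
    rw [shiftedColumns_mulVec_update e he w x i v c hc, Complex.normSq_eq_norm_sq]
    simp [-Finset.sum_erase_eq_sub]

/-- The columns that do not enter the left inverse are independent of it, so pairing one of them
with a fixed row of the left inverse gives a centred Gaussian of variance the square of the norm of
that row. -/
theorem gaussianColumns_leftInv_gt_le (e : s → ι) (w : s → κ → ℂ) (T : ℝ) (hT : 0 ≤ T) (i : s)
    (q : ι) (hq : ∀ l, e l ≠ q) :
    gaussianColumns ι κ {x | T * ∑ a, Complex.normSq (leftInv (shiftedColumns e w x) i a) <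
        Complex.normSq (∑ a, leftInv (shiftedColumns e w x) i a * x q a)} ≤
      ENNReal.ofReal (4 * Real.exp (1 / 4 - √(T / 2))) := by
  have hm : ∀ a, Measurable fun x : ι → κ → ℂ => leftInv (shiftedColumns e w x) i a := fun a =>
    measurable_leftInv_apply _ (continuous_shiftedColumns e w) i a
  have hn : Measurable Complex.normSq := Complex.continuous_normSq.measurable
  refine pi_le_of_forall_update_le _ q _ ?_ _ fun x => ?_
  · refine measurableSet_lt ?_ ?_
    · exact (Finset.measurable_fun_sum _ fun a _ => hn.comp (hm a)).const_mul T
    · refine hn.comp (Finset.measurable_fun_sum _ fun a _ => (hm a).mul ?_)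
      fun_prop
  · refine le_trans (measure_mono fun v hv => ?_)
      (gaussianVector_normSq_gt_le (leftInv (shiftedColumns e w x) i) T hT)
    simpa [shiftedColumns_update_of_notMem e w x q hq] using hv

/-- The typical behaviour of the left inverse `Y` of the matrix of shifted columns: it exists, its
rows have norm at most `√(2 / d)`, and pairing a row with a column that is not selected
costs at most a factor `√T`. -/
structure IsTypical (e : s → ι) (w : s → κ → ℂ) (d : ℕ) (T : ℝ) (x : ι → κ → ℂ) : Prop where
  leftInv_mul : leftInv (shiftedColumns e w x) * shiftedColumns e w x = 1
  row_le : ∀ i, ∑ a, Complex.normSq (leftInv (shiftedColumns e w x) i a) ≤ 2 / d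
  pairing_le : ∀ i q, (∀ l, e l ≠ q) →
    Complex.normSq (∑ a, leftInv (shiftedColumns e w x) i a * x q a) ≤
      T * ∑ a, Complex.normSq (leftInv (shiftedColumns e w x) i a)

theorem gaussianColumns_not_isTypical_le (e : s → ι) (he : Function.Injective e) (w : s → κ → ℂ)
    (d : ℕ) (hd0 : 0 < d) (hd : d + Fintype.card s ≤ Fintype.card κ + 1) (T : ℝ) (hT : 0 ≤ T) :
    gaussianColumns ι κ {x | ¬ IsTypical e w d T x} ≤
      ENNReal.ofReal (Fintype.card s * (√(Real.exp 1) / 2) ^ d +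
        Fintype.card s * Fintype.card ι * (4 * Real.exp (1 / 4 - √(T / 2)))) := by
  classical
  set D : s → Set (ι → κ → ℂ) := fun i => {x | ∃ c : s → ℂ, c i = 1 ∧
        ∑ a, Complex.normSq ((shiftedColumns e w x *ᵥ c) a) < d / 2}
  set F : s × {q : ι // ∀ l, e l ≠ q} → Set (ι → κ → ℂ) := fun p =>
    {x | T * ∑ a, Complex.normSq (leftInv (shiftedColumns e w x) p.1 a) <
        Complex.normSq (∑ a, leftInv (shiftedColumns e w x) p.1 a * x p.2.1 a)}
  have hsub : {x | ¬ IsTypical e w d T x} ⊆ (⋃ i, D i) ∪ ⋃ p, F p := by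
    intro x hx
    by_contra hcon
    simp only [D, F, Set.mem_union, Set.mem_iUnion, Set.mem_ofPred_eq, not_or, not_exists,
      not_and, not_lt] at hcon
    obtain ⟨h1, h2⟩ := hcon
    have hτ : (0 : ℝ) < d / 2 := by positivity
    refine hx ⟨leftInv_mul_self _ _ hτ h1, fun i => ?_, fun i q hq => h2 (i, ⟨q, hq⟩)⟩
    refine (sum_normSq_leftInv_le _ _ hτ h1 i).trans (le_of_eq ?_)
    rw [one_div_div]
  have hp : (0 : ℝ) ≤ (√(Real.exp 1) / 2) ^ d := by positivity
  have hp' : (0 : ℝ) ≤ 4 * Real.exp (1 / 4 - √(T / 2)) := by positivity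
  refine (measure_mono hsub).trans ((measure_union_le _ _).trans ?_)
  rw [ENNReal.ofReal_add (by positivity) (by positivity)]
  refine add_le_add ?_ ?_
  · refine (measure_iUnion_fintype_le _ _).trans ((Finset.sum_le_sum fun i _ =>
      gaussianColumns_near_span_le e he w d hd i).trans ?_)
    rw [Finset.sum_const, Finset.card_univ, nsmul_eq_mul, ENNReal.ofReal_mul (by positivity),
      ENNReal.ofReal_natCast]
  · refine (measure_iUnion_fintype_le _ _).trans ((Finset.sum_le_sum fun p _ =>
      gaussianColumns_leftInv_gt_le e w T hT p.1 p.2.1 p.2.2).trans ?_)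
    rw [Finset.sum_const, Finset.card_univ, nsmul_eq_mul, ← Nat.cast_mul,
      ENNReal.ofReal_mul (Nat.cast_nonneg _), ENNReal.ofReal_natCast, Fintype.card_prod]
    gcongr
    exact Fintype.card_subtype_le _

end Columns

/-- Independent standard complex normal entries, grouped into columns, follow the product law
`gaussianColumns`. -/
theorem hasLaw_gaussianColumns {Ω : Type*} [MeasurableSpace Ω] {P : Measure Ω}
    [IsProbabilityMeasure P] {ι κ : Type*} [Fintype ι] [Fintype κ]
    (X : ι × κ → Ω → ℂ) (hX : ∀ p, HasLaw (X p) stdComplexGaussian P) (hi : iIndepFun X P) :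
    HasLaw (fun ω (q : ι) (a : κ) => X (q, a) ω) (gaussianColumns ι κ) P := by
  have h := hi.hasLaw_infinitePi (μ := fun _ => stdComplexGaussian) hX
    (aemeasurable_pi_lambda _ fun p => (hX p).aemeasurable)
  have hc := Measure.infinitePi_map_curry fun (_ : ι) (_ : κ) => stdComplexGaussian
  simp_rw [Measure.infinitePi_eq_pi] at hc
  rw [Measure.infinitePi_eq_pi] at h
  have hcl : HasLaw (MeasurableEquiv.curry ι κ ℂ) (gaussianColumns ι κ)
      (Measure.pi fun _ => stdComplexGaussian) :=
    ⟨(MeasurableEquiv.measurable _).aemeasurable, hc⟩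
  exact hcl.comp h
end MonicGaussian

/-! ### Block elimination -/

namespace MonicGaussian

section Companion
variable {k n m : ℕ}
open scoped Matrix

/-- The matrix `n^{-1/2} E₁ Cᵀ - z I`. -/
noncomputable def companion (C : Fin k → Matrix (Fin n) (Fin n) ℂ) (z : ℂ) :
    Matrix (Fin k × Fin n) (Fin k × Fin n) ℂ :=
  (((n : ℝ) ^ (-(1 / 2) : ℝ) : ℝ) : ℂ) • (E₁ k n * CT C) - z • 1

theorem companion_apply (C : Fin k → Matrix (Fin n) (Fin n) ℂ) (z : ℂ) (p q : Fin k × Fin n) :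
    companion C z p q =
      (if (p.1 : ℕ) = 0 then
        -((((n : ℝ) ^ (-(1 / 2) : ℝ) : ℝ) : ℂ) * C (Fin.rev q.1) p.2 q.2) else 0) -
      z * (if p = q then 1 else 0) := by
  simp only [companion, Matrix.sub_apply, Matrix.smul_apply, smul_eq_mul, Matrix.one_apply]
  congr 1
  rw [Matrix.mul_apply]
  split_ifs with h
  · simp [E₁, CT, h, Matrix.one_apply]
  · simp [E₁, h]

/-- The columns of all coefficients, as a family of vectors. -/
def coeffColumns (C : Fin k → Matrix (Fin n) (Fin n) ℂ) : Fin k × Fin n → Fin n → ℂ :=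
  fun q a => C q.1 a q.2

/-- The position of the `i`-th column of the leading block, for `i < m`. -/
def leadingColumn (hk : 0 < k) (hm : m ≤ n) (i : Fin m) : Fin k × Fin n :=
  (Fin.rev ⟨0, hk⟩, Fin.castLE hm i)

theorem leadingColumn_injective (hk : 0 < k) (hm : m ≤ n) :
    Function.Injective (leadingColumn hk hm) := by
  intro i j h
  simpa [leadingColumn] using h

/-- The shift that turns the first `m` columns of the leading coefficient into those of
`-√n` times the leading block of `n^{-1/2} E₁ Cᵀ - z I`. -/
noncomputable def diagonalShift (hm : m ≤ n) (z : ℂ) (i : Fin m) (a : Fin n) : ℂ :=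
  if a = Fin.castLE hm i then (√n : ℝ) * z else 0

/-- The vectors whose leading block is supported on its first `m` coordinates. -/
def leadingSupported (k n m : ℕ) : Submodule ℂ (EuclideanSpace ℂ (Fin k × Fin n)) where
  carrier := {v | ∀ q : Fin k × Fin n, (q.1 : ℕ) = 0 → m ≤ (q.2 : ℕ) → v q = 0}
  add_mem' := by
    intro v w hv hw q h0 hq
    simp [hv q h0 hq, hw q h0 hq]
  zero_mem' := by simp
  smul_mem' := by
    intro c v hv q h0 hq
    simp [hv q h0 hq]

theorem le_finrank_leadingSupported (hm : m ≤ n) :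
    k * n ≤ Module.finrank ℂ (leadingSupported k n m) + (n - m) := by
  rcases Nat.eq_zero_or_pos k with rfl | hk
  · simp
  set R : EuclideanSpace ℂ (Fin k × Fin n) →ₗ[ℂ] (Fin (n - m) → ℂ) :=
    { toFun := fun v l => v (⟨0, hk⟩, ⟨m + l, by omega⟩)
      map_add' := fun _ _ => rfl
      map_smul' := fun _ _ => rfl } with hR
  have h1 := R.finrank_range_add_finrank_ker
  have h2 : LinearMap.ker R ≤ leadingSupported k n m := by
    rintro v hv ⟨j, b⟩ hj hb
    have h := congr_fun (LinearMap.mem_ker.1 hv) ⟨b - m, by have := b.2; omega⟩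
    have e1 : j = ⟨0, hk⟩ := Fin.ext hj
    have e2 : b = ⟨m + (b - m), by have := b.2; omega⟩ := Fin.ext (by simp at hb ⊢; omega)
    rw [e1, e2]
    exact h
  have h3 := Submodule.finrank_mono h2
  have h4 := Submodule.finrank_le (LinearMap.range R)
  simp only [finrank_euclideanSpace, Fintype.card_prod, Fintype.card_fin,
    Module.finrank_fintype_fun_eq_card] at h1 h4
  omega

/-- A left inverse of `n^{-1/2} E₁ Cᵀ - z I` on the vectors with leading block supported on the
first `m` coordinates, obtained by block elimination from a left inverse `Y` of the selected columns
of the leading block. -/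
noncomputable def companionLeftInv (C : Fin k → Matrix (Fin n) (Fin n) ℂ) (z : ℂ)
    (Y : Matrix (Fin m) (Fin n) ℂ) : Matrix (Fin k × Fin n) (Fin k × Fin n) ℂ :=
  Matrix.of fun p q =>
    if (p.1 : ℕ) = 0 then
      if hb : (p.2 : ℕ) < m then
        if (q.1 : ℕ) = 0 then -((√n : ℝ) * Y ⟨p.2, hb⟩ q.2)
        else z⁻¹ * ∑ a, Y ⟨p.2, hb⟩ a * C (Fin.rev q.1) a q.2
      else 0
    else if p = q then -z⁻¹ else 0

/-- Write `y` for the image of `v`. The lower blocks give `v = -z⁻¹ y` there; the top block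
expresses `A` applied to the leading block of `v` through `y` and the lower blocks of `v`, and `Y`
inverts `A`. -/
theorem companionLeftInv_mul (hk : 0 < k) (hn : 0 < n) (hm : m ≤ n) (z : ℂ) (hz : z ≠ 0)
    (C : Fin k → Matrix (Fin n) (Fin n) ℂ) (Y : Matrix (Fin m) (Fin n) ℂ)
    (hY : Y * shiftedColumns (leadingColumn hk hm) (diagonalShift hm z) (coeffColumns C) = 1)
    (v : EuclideanSpace ℂ (Fin k × Fin n)) (hv : v ∈ leadingSupported k n m)
    (p : Fin k × Fin n) :
    v p = ∑ q, companionLeftInv C z Y p q * (Matrix.toEuclideanLin (companion C z) v) q := by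
  obtain ⟨y, hy⟩ : ∃ y, y = Matrix.toEuclideanLin (companion C z) v := ⟨_, rfl⟩
  have hyv : ∀ q, y q = ∑ r, companion C z q r * v r := fun q => by rw [hy]; rfl
  rw [← hy]
  have hlow : ∀ q : Fin k × Fin n, (q.1 : ℕ) ≠ 0 → y q = -(z * v q) := by
    intro q hq
    rw [hyv]
    simp [companion_apply, hq]
  by_cases hp : (p.1 : ℕ) = 0
  swap
  · simp [companionLeftInv, hp, hlow, hz]
  by_cases hb : (p.2 : ℕ) < m
  swap
  · rw [hv p hp (not_lt.1 hb)]
    simp [companionLeftInv, hp, hb]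
  set A := shiftedColumns (leadingColumn hk hm) (diagonalShift hm z) (coeffColumns C) with hA
  set i : Fin m := ⟨p.2, hb⟩ with hi
  set j₀ : Fin k := ⟨0, hk⟩ with hj₀
  have hsplit : ∀ F : Fin k × Fin n → ℂ, ∑ q, F q =
      ∑ a, F (j₀, a) + ∑ q : Fin k × Fin n, if (q.1 : ℕ) = 0 then 0 else F q := by
    intro F
    have h1 : ∑ a, F (j₀, a) = ∑ q : Fin k × Fin n, if (q.1 : ℕ) = 0 then F q else 0 := by
      refine Fintype.sum_of_injective (fun a => (j₀, a)) (Prod.mk_right_injective _) _ _ ?_ ?_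
      · rintro ⟨j, b⟩ hq
        refine if_neg fun h => hq ⟨b, ?_⟩
        exact Prod.ext (Fin.ext h.symm) rfl
      · intro a
        simp [hj₀]
    rw [h1, ← Finset.sum_add_distrib]
    refine Finset.sum_congr rfl fun q _ => ?_
    split_ifs <;> simp
  have hn' : (√n : ℝ) * ((n : ℝ) ^ (-(1 / 2) : ℝ)) = 1 := by
    rw [Real.rpow_neg (Nat.cast_nonneg n), ← Real.sqrt_eq_rpow]
    exact mul_inv_cancel₀ (Real.sqrt_pos.2 (by exact_mod_cast hn)).ne'
  have hn'' : ((√n : ℝ) : ℂ) * (((n : ℝ) ^ (-(1 / 2) : ℝ) : ℝ) : ℂ) = 1 := by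
    exact_mod_cast hn'
  have htop : ∀ a, ((√n : ℝ) : ℂ) * y (j₀, a) =
      -(∑ l, A a l * v (j₀, Fin.castLE hm l)) -
        ∑ q : Fin k × Fin n, if (q.1 : ℕ) = 0 then 0 else C (Fin.rev q.1) a q.2 * v q := by
    intro a
    have h1 : ((√n : ℝ) : ℂ) * y (j₀, a) = -∑ q : Fin k × Fin n,
        (C (Fin.rev q.1) a q.2 + (√n : ℝ) * z * if (j₀, a) = q then 1 else 0) * v q := by
      rw [hyv, Finset.mul_sum, ← Finset.sum_neg_distrib]
      refine Finset.sum_congr rfl fun q _ => ?_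
      rw [companion_apply, if_pos (by simp [hj₀])]
      linear_combination (-(C (Fin.rev q.1) a q.2 * v q)) * hn''
    rw [h1, hsplit, neg_add, ← sub_eq_add_neg]
    refine congrArg₂ (fun s t : ℂ => -s - t) ?_ ?_
    · symm
      refine Fintype.sum_of_injective (Fin.castLE hm) (Fin.castLE_injective hm) _ _ ?_ ?_
      · intro b hb
        have hmb : m ≤ b := by
          by_contra hlt
          exact hb ⟨⟨b, not_le.1 hlt⟩, rfl⟩
        rw [hv (j₀, b) (by simp [hj₀]) hmb, mul_zero]
      · intro l
        simp only [hA, shiftedColumns, leadingColumn, coeffColumns, diagonalShift, Matrix.of_apply,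
          Prod.mk.injEq, true_and, mul_ite, mul_one, mul_zero, ← hj₀]
    · refine Finset.sum_congr rfl fun q _ => ?_
      split_ifs with hq hq'
      · rfl
      · exact absurd (congrArg (fun r : Fin k × Fin n => (r.1 : ℕ)) hq').symm hq
      · simp
  rw [hsplit]
  have hL0 : ∀ a, companionLeftInv C z Y p (j₀, a) * y (j₀, a) =
      ∑ l, Y i a * A a l * v (j₀, Fin.castLE hm l) +
        ∑ q : Fin k × Fin n, if (q.1 : ℕ) = 0 then 0 else Y i a * C (Fin.rev q.1) a q.2 * v q := by
    intro a
    have h1 : companionLeftInv C z Y p (j₀, a) = -((√n : ℝ) * Y i a) := by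
      simp [companionLeftInv, hp, hb, hj₀, hi]
    have h2 : companionLeftInv C z Y p (j₀, a) * y (j₀, a) =
        -(Y i a * (((√n : ℝ) : ℂ) * y (j₀, a))) := by rw [h1]; ring
    rw [h2, htop, mul_sub, mul_neg, neg_sub, sub_neg_eq_add, add_comm, Finset.mul_sum,
      Finset.mul_sum]
    congr 1
    · exact Finset.sum_congr rfl fun l _ => (mul_assoc _ _ _).symm
    · refine Finset.sum_congr rfl fun q _ => ?_
      split_ifs
      · simp
      · ring
  have hL1 : ∀ q : Fin k × Fin n,
      (if (q.1 : ℕ) = 0 then 0 else companionLeftInv C z Y p q * y q) =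
        -∑ a, if (q.1 : ℕ) = 0 then 0 else Y i a * C (Fin.rev q.1) a q.2 * v q := by
    intro q
    split_ifs with hq
    · simp
    · rw [hlow q hq, ← Finset.sum_mul]
      simp only [companionLeftInv, Matrix.of_apply, hp, hb, hq, if_true, dif_pos, if_false, ← hi]
      field_simp
  have hone : ∑ a, ∑ l, Y i a * A a l * v (j₀, Fin.castLE hm l) = v p := by
    rw [Finset.sum_comm]
    simp_rw [← Finset.sum_mul]
    have h1 : ∀ l, ∑ a, Y i a * A a l = if i = l then 1 else 0 := fun l => by
      rw [← Matrix.mul_apply, hY, Matrix.one_apply]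
    simp only [h1, ite_mul, one_mul, zero_mul, Finset.sum_ite_eq, Finset.mem_univ, if_true]
    have hpi : (j₀, Fin.castLE hm i) = p := Prod.ext (Fin.ext hp.symm) rfl
    rw [hpi]
  simp_rw [hL0, hL1]
  rw [Finset.sum_add_distrib, hone, Finset.sum_neg_distrib, Finset.sum_comm, add_neg_cancel_right]

/-- For typical columns, each of the `k * n` rows of the left inverse obeys the same bound. -/
theorem sum_normSq_companionLeftInv_le (hk : 0 < k) (hm : m ≤ n) (z : ℂ)
    (C : Fin k → Matrix (Fin n) (Fin n) ℂ) (d : ℕ) (T : ℝ) (hT : 0 ≤ T)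
    (h : IsTypical (leadingColumn hk hm) (diagonalShift hm z) d T (coeffColumns C)) :
    ∑ p, ∑ q, Complex.normSq (companionLeftInv C z
        (leftInv (shiftedColumns (leadingColumn hk hm) (diagonalShift hm z) (coeffColumns C))) p q)
      ≤ k * n * (2 / d * (n + k * n * T / Complex.normSq z) + 1 / Complex.normSq z) := by
  set Y := leftInv (shiftedColumns (leadingColumn hk hm) (diagonalShift hm z) (coeffColumns C))
    with hY
  have hz0 : 0 ≤ Complex.normSq z := Complex.normSq_nonneg z
  set R : ℝ := 2 / d * (n + k * n * T / Complex.normSq z) + 1 / Complex.normSq z with hR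
  have hR0 : 0 ≤ R := by positivity
  have hrow : ∀ p, ∑ q, Complex.normSq (companionLeftInv C z Y p q) ≤ R := by
    intro p
    by_cases hp : (p.1 : ℕ) = 0
    swap
    · have : ∑ q, Complex.normSq (companionLeftInv C z Y p q) = 1 / Complex.normSq z := by
        rw [Finset.sum_eq_single p]
        · simp [companionLeftInv, hp]
        · intro q _ hq
          simp [companionLeftInv, hp, hq.symm]
        · simp
      rw [this, hR]
      have : 0 ≤ 2 / d * (n + k * n * T / Complex.normSq z) := by positivity
      linarith
    by_cases hb : (p.2 : ℕ) < m
    swap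
    · simpa [companionLeftInv, hp, hb] using hR0
    set i : Fin m := ⟨p.2, hb⟩ with hi
    set c : ℝ := T * (2 / d) / Complex.normSq z with hc
    have hc0 : 0 ≤ c := by positivity
    have hq : ∀ q : Fin k × Fin n, Complex.normSq (companionLeftInv C z Y p q) ≤
        (if q.1 = ⟨0, hk⟩ then n * Complex.normSq (Y i q.2) else 0) + c := by
      intro q
      by_cases hq : (q.1 : ℕ) = 0
      · have hq' : q.1 = ⟨0, hk⟩ := Fin.ext hq
        rw [if_pos hq']
        simp only [companionLeftInv, Matrix.of_apply, hp, hb, hq, if_true, dif_pos]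
        rw [Complex.normSq_neg, Complex.normSq_mul, Complex.normSq_ofReal,
          Real.mul_self_sqrt (Nat.cast_nonneg n)]
        linarith
      · have hq' : q.1 ≠ ⟨0, hk⟩ := fun h => hq (by rw [h])
        rw [if_neg hq', zero_add]
        simp only [companionLeftInv, Matrix.of_apply, hp, hb, hq, if_true, dif_pos, if_false]
        rw [Complex.normSq_mul, Complex.normSq_inv, hc, div_eq_inv_mul]
        have h1 := h.pairing_le i (Fin.rev q.1, q.2) (fun l hl => hq' (by
          simp only [leadingColumn, Prod.mk.injEq, Fin.rev_inj] at hl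
          exact hl.1.symm))
        have h2 := h.row_le i
        gcongr
        exact h1.trans (by gcongr)
    refine (Finset.sum_le_sum fun q _ => hq q).trans ?_
    rw [Finset.sum_add_distrib, Fintype.sum_prod_type]
    have h1 : ∑ j : Fin k, ∑ b : Fin n,
        (if j = ⟨0, hk⟩ then n * Complex.normSq (Y i b) else 0) =
        n * ∑ b, Complex.normSq (Y i b) := by
      rw [Finset.sum_comm, Finset.mul_sum]
      simp
    rw [h1, Finset.sum_const, Finset.card_univ, Fintype.card_prod, Fintype.card_fin,
      Fintype.card_fin, nsmul_eq_mul]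
    have h2 : (n : ℝ) * ∑ b, Complex.normSq (Y i b) ≤ n * (2 / d) := by
      gcongr
      exact h.row_le i
    have h3 : 0 ≤ 1 / Complex.normSq z := by positivity
    have h4 : ((k * n : ℕ) : ℝ) * c = 2 / d * (k * n * T / Complex.normSq z) := by
      rw [hc]; push_cast; ring
    rw [h4, hR]
    linarith
  refine (Finset.sum_le_sum fun p _ => hrow p).trans (le_of_eq ?_)
  rw [Finset.sum_const, Finset.card_univ, Fintype.card_prod, Fintype.card_fin,
      Fintype.card_fin, nsmul_eq_mul]
  push_cast
  rfl

theorem sub_le_singularValues_companion_sq_mul (hk : 0 < k) (hn : 0 < n) (hm : m ≤ n) (z : ℂ)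
    (hz : z ≠ 0) (C : Fin k → Matrix (Fin n) (Fin n) ℂ) (d : ℕ) (T : ℝ) (hT : 0 ≤ T)
    (h : IsTypical (leadingColumn hk hm) (diagonalShift hm z) d T (coeffColumns C)) (i : ℕ)
    (hi : i < k * n) :
    (k * n : ℝ) - (n - m) - i ≤
      (Matrix.toEuclideanLin (companion C z)).singularValues i ^ 2 *
        (k * n * (2 / d * (n + k * n * T / Complex.normSq z) + 1 / Complex.normSq z)) := by
  have h1 := finrank_sub_le_singularValues_sq_mul (companion C z) (companionLeftInv C z
    (leftInv (shiftedColumns (leadingColumn hk hm) (diagonalShift hm z) (coeffColumns C))))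
    (leadingSupported k n m)
    (fun v hv p => companionLeftInv_mul hk hn hm z hz C _ h.leftInv_mul v hv p) i
    (by simpa using hi)
  have h2 : ((k * n : ℕ) : ℝ) ≤ ((Module.finrank ℂ (leadingSupported k n m) + (n - m) : ℕ) : ℝ) := by
    exact_mod_cast le_finrank_leadingSupported hm
  push_cast [Nat.cast_sub hm] at h2
  have h3 := sum_normSq_companionLeftInv_le hk hm z C d T hT h
  have h4 := mul_le_mul_of_nonneg_left h3
    (sq_nonneg ((Matrix.toEuclideanLin (companion C z)).singularValues i))
  linarith
end Companion
end MonicGaussian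

/-! ### Asymptotics and the conclusion -/

namespace MonicGaussian

section Asymptotics

theorem summable_sq_mul_exp_neg_rpow (b s : ℝ) (hb : 0 < b) (hs : 0 < s) :
    Summable fun n : ℕ => (n : ℝ) ^ 2 * Real.exp (-b * (n : ℝ) ^ s) := by
  have h1 := isLittleO_exp_neg_mul_rpow_atTop hb (-4 / s)
  have h2 : Tendsto (fun n : ℕ => (n : ℝ) ^ s) atTop atTop :=
    (tendsto_rpow_atTop hs).comp tendsto_natCast_atTop_atTop
  have h3 := (h1.comp_tendsto h2).isBigO
  have h4 := (Asymptotics.isBigO_refl (fun n : ℕ => (n : ℝ) ^ 2) atTop).mul h3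
  refine summable_of_isBigO_nat (Real.summable_nat_rpow.2 (by norm_num : (-2 : ℝ) < -1)) ?_
  refine h4.trans (Asymptotics.IsBigO.of_bound 1 ?_)
  filter_upwards [eventually_gt_atTop 0] with n hn
  have hn' : (0 : ℝ) < n := by exact_mod_cast hn
  simp only [Function.comp_apply]
  rw [← Real.rpow_mul hn'.le, mul_div_cancel₀ _ hs.ne', ← Real.rpow_natCast, ← Real.rpow_add hn',
    one_mul]
  norm_num

/-- The number `⌊n^{1-δ} / 2⌋` of columns of the leading block to discard: half of the `n^{1-δ}`
indices beyond `f(n)`, so that the other half remains for the dimension count. -/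
noncomputable def discarded (δ : ℝ) (n : ℕ) : ℕ := ⌊(n : ℝ) ^ (1 - δ) / 2⌋₊

theorem rpow_one_sub_le {δ : ℝ} (hδ₀ : 0 < δ) (hδ : δ < 1 / 2) (n : ℕ) :
    (n : ℝ) ^ (1 - δ) ≤ n := by
  rcases Nat.eq_zero_or_pos n with rfl | hn
  · rw [Nat.cast_zero, Real.zero_rpow (by linarith)]
  · have h1 : (1 : ℝ) ≤ n := by exact_mod_cast hn
    simpa using Real.rpow_le_rpow_of_exponent_le h1 (by linarith : 1 - δ ≤ 1)

theorem discarded_cast_le (δ : ℝ) (n : ℕ) : (discarded δ n : ℝ) ≤ (n : ℝ) ^ (1 - δ) / 2 :=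
  Nat.floor_le (by positivity)

theorem discarded_le {δ : ℝ} (hδ₀ : 0 < δ) (hδ : δ < 1 / 2) (n : ℕ) : discarded δ n ≤ n := by
  have h1 := discarded_cast_le δ n
  have h2 := rpow_one_sub_le hδ₀ hδ n
  have h3 : (0 : ℝ) ≤ n := Nat.cast_nonneg n
  have : (discarded δ n : ℝ) ≤ n := by linarith
  exact_mod_cast this

/-- The failure probabilities in `gaussianColumns_not_isTypical_le` are summable for
`d = discarded δ n + 1` and `T = n ^ ε`. -/
theorem summable_failure_probability (k : ℕ) {δ : ℝ} (hδ₀ : 0 < δ) (hδ : δ < 1 / 2) {ε : ℝ}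
    (hε : 0 < ε) :
    Summable fun n : ℕ =>
      ((n - discarded δ n : ℕ) : ℝ) * (√(Real.exp 1) / 2) ^ (discarded δ n + 1) +
        ((n - discarded δ n : ℕ) : ℝ) * ((k * n : ℕ) : ℝ) *
          (4 * Real.exp (1 / 4 - √((n : ℝ) ^ ε / 2))) := by
  set c := √(Real.exp 1) / 2 with hc
  have hc0 : 0 < c := by positivity
  have hc1 : c < 1 := sqrt_exp_one_div_two_lt_one
  have hm : ∀ n : ℕ, ((n - discarded δ n : ℕ) : ℝ) ≤ n := fun n => by
    exact_mod_cast Nat.sub_le _ _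
  have hlog : 0 < -Real.log c / 2 := by
    have := Real.log_neg hc0 hc1
    linarith
  have s1 := summable_sq_mul_exp_neg_rpow (-Real.log c / 2) (1 - δ) hlog (by linarith)
  have s2 := (summable_sq_mul_exp_neg_rpow (√2)⁻¹ (ε / 2) (by positivity) (by linarith)).mul_left
    (4 * k * Real.exp (1 / 4))
  refine Summable.add (Summable.of_nonneg_of_le (fun n => by positivity) (fun n => ?_) s1)
    (Summable.of_nonneg_of_le (fun n => by positivity) (fun n => ?_) s2)
  · have h1 : c ^ (discarded δ n + 1) ≤ Real.exp (-(-Real.log c / 2) * (n : ℝ) ^ (1 - δ)) := by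
      rw [← Real.rpow_natCast, Real.rpow_def_of_pos hc0, Real.exp_le_exp]
      have h2 : (n : ℝ) ^ (1 - δ) / 2 < discarded δ n + 1 := Nat.lt_floor_add_one _
      push_cast
      nlinarith
    have h3 : (n : ℝ) ≤ (n : ℝ) ^ 2 := by exact_mod_cast Nat.le_self_pow two_ne_zero n
    exact mul_le_mul ((hm n).trans h3) h1 (by positivity) (by positivity)
  · have h1 : Real.exp (1 / 4 - √((n : ℝ) ^ ε / 2)) =
        Real.exp (1 / 4) * Real.exp (-(√2)⁻¹ * (n : ℝ) ^ (ε / 2)) := by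
      rw [← Real.exp_add]
      congr 1
      rw [Real.sqrt_div (by positivity), Real.sqrt_eq_rpow ((n : ℝ) ^ ε),
        ← Real.rpow_mul (Nat.cast_nonneg n)]
      ring_nf
    rw [h1]
    have h2 : ((n - discarded δ n : ℕ) : ℝ) * ((k * n : ℕ) : ℝ) ≤ n * (k * n) := by
      rw [Nat.cast_mul]
      gcongr
      exact Nat.sub_le _ _
    calc _ ≤ n * (k * n) * (4 * (Real.exp (1 / 4) *
          Real.exp (-(√2)⁻¹ * (n : ℝ) ^ (ε / 2)))) := by gcongr
      _ = _ := by ring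

/-- The constant `t` of the lower bound, as a function of `k` and `|z|²`. -/
noncomputable def lowerConstant (k : ℕ) (Z : ℝ) : ℝ := √(1 / (2 * k * (4 + 5 * k / Z)))

/-- The bound of `sub_le_singularValues_companion_sq_mul` rearranged for `σ`: the bracket is
`O(n^{δ+ε})`, and `3 * ε = 1 - 2 * δ` turns `n^{-2δ-ε}` into `n^{2ε-1}`. -/
theorem le_of_normalized_bound {k n : ℕ} (hk : 2 ≤ k) (hn : 0 < n) {δ ε Z σ : ℝ} (hδ₀ : 0 < δ)
    (hδ : δ < 1 / 2) (hε : 3 * ε = 1 - 2 * δ) (hZ : 0 < Z) (hσ : 0 ≤ σ)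
    (h : (n : ℝ) ^ (1 - δ) / 2 ≤ σ ^ 2 * (k * n * (2 / ((discarded δ n + 1 : ℕ) : ℝ) *
      (n + k * n * (n : ℝ) ^ ε / Z) + 1 / Z))) :
    lowerConstant k Z * (n : ℝ) ^ (ε - 1 / 2) ≤ σ := by
  have hn1 : (1 : ℝ) ≤ n := by exact_mod_cast hn
  have hn0 : (0 : ℝ) < n := by linarith
  have hk1 : (1 : ℝ) ≤ k := by exact_mod_cast (by omega : 1 ≤ k)
  set T := (n : ℝ) ^ ε with hT
  set D := (n : ℝ) ^ δ with hD
  have hT1 : 1 ≤ T := Real.one_le_rpow hn1 (by linarith)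
  have hD1 : 1 ≤ D := Real.one_le_rpow hn1 hδ₀.le
  set Q := (n : ℝ) ^ (1 - δ) with hQ
  have hQ0 : 0 < Q := by positivity
  have hQD : Q * D = n := by rw [hQ, hD, ← Real.rpow_add hn0]; simp
  have hd : 2 / ((discarded δ n + 1 : ℕ) : ℝ) ≤ 4 / Q := by
    have h2 : Q / 2 < discarded δ n + 1 := Nat.lt_floor_add_one _
    rw [div_le_div_iff₀ (by positivity) hQ0]
    push_cast
    linarith
  set K := 4 + 5 * k / Z with hK
  have hK0 : 0 < K := by positivity
  have hbr : 2 / ((discarded δ n + 1 : ℕ) : ℝ) * (n + k * n * T / Z) + 1 / Z ≤ D * T * K := by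
    have e1 : 4 / Q * (n + k * n * T / Z) = 4 * D + 4 * (D * T * (k / Z)) := by
      rw [← hQD]; field_simp
    have e2 : 1 / Z ≤ D * T * (k / Z) := by
      have : 1 ≤ D * T * k := one_le_mul_of_one_le_of_one_le
        (one_le_mul_of_one_le_of_one_le hD1 hT1) hk1
      rw [← mul_div_assoc]
      gcongr
    have e3 : D ≤ D * T := le_mul_of_one_le_right (by linarith) hT1
    calc _ ≤ 4 / Q * (n + k * n * T / Z) + 1 / Z := by gcongr
      _ ≤ 4 * (D * T) + 4 * (D * T * (k / Z)) + D * T * (k / Z) := by rw [e1]; linarith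
      _ = D * T * K := by rw [hK]; ring
  have h1 : Q / 2 ≤ σ ^ 2 * (k * n * (D * T * K)) := h.trans (by gcongr)
  refine abs_le_of_sq_le_sq' ?_ hσ |>.2
  rw [mul_pow, lowerConstant, Real.sq_sqrt (by positivity), ← hK]
  have hpow : ((n : ℝ) ^ (ε - 1 / 2)) ^ 2 * (n * (D * T)) = Q := by
    rw [← Real.rpow_natCast, ← Real.rpow_mul hn0.le, hD, hT, hQ]
    nth_rewrite 2 [← Real.rpow_one (n : ℝ)]
    rw [← Real.rpow_add hn0, ← Real.rpow_add hn0, ← Real.rpow_add hn0]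
    congr 1
    push_cast
    linarith
  have hnDT : 0 < n * (D * T) := by positivity
  refine le_of_mul_le_mul_right ?_ hnDT
  calc _ = 1 / (2 * k * K) * (((n : ℝ) ^ (ε - 1 / 2)) ^ 2 * (n * (D * T))) := by ring
    _ = Q / 2 * (1 / (k * K)) := by rw [hpow]; field_simp
    _ ≤ σ ^ 2 * (k * n * (D * T * K)) * (1 / (k * K)) := by gcongr
    _ = _ := by field_simp

theorem lowerConstant_pos {k : ℕ} (hk : 2 ≤ k) {Z : ℝ} (hZ : 0 < Z) : 0 < lowerConstant k Z := by
  have : (0 : ℝ) < k := by exact_mod_cast (by omega : 0 < k)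
  unfold lowerConstant
  positivity

theorem lowerConstant_le_one {k : ℕ} (hk : 2 ≤ k) {Z : ℝ} (hZ : 0 < Z) :
    lowerConstant k Z ≤ 1 := by
  have hk' : (2 : ℝ) ≤ k := by exact_mod_cast hk
  have h : (0 : ℝ) ≤ 5 * k / Z := by positivity
  refine Real.sqrt_le_one.2 ?_
  rw [div_le_one (by positivity)]
  nlinarith

end Asymptotics

theorem le_sigma_of_isTypical {k n : ℕ} (hk : 2 ≤ k) (hn : 0 < n) {δ ε : ℝ} (hδ₀ : 0 < δ)
    (hδ : δ < 1 / 2) (hε : 3 * ε = 1 - 2 * δ) {z : ℂ} (hz : z ≠ 0)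
    (C : Fin k → Matrix (Fin n) (Fin n) ℂ)
    (h : IsTypical (leadingColumn (by omega : 0 < k) (Nat.sub_le n (discarded δ n)))
      (diagonalShift (Nat.sub_le n (discarded δ n)) z) (discarded δ n + 1) ((n : ℝ) ^ ε)
      (coeffColumns C)) :
    lowerConstant k (Complex.normSq z) * (n : ℝ) ^ (ε - 1 / 2) ≤
      sigma (f k δ n) (companion C z) := by
  have hn1 : (1 : ℝ) ≤ n := by exact_mod_cast hn
  have hk2 : (2 : ℝ) ≤ k := by exact_mod_cast hk
  have hQn := rpow_one_sub_le hδ₀ hδ n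
  have hx : 1 ≤ (k : ℝ) * n - (n : ℝ) ^ (1 - δ) := by nlinarith
  have hf1 : 1 ≤ f k δ n := Nat.le_floor (by exact_mod_cast hx)
  have hf2 : (f k δ n : ℝ) ≤ k * n - (n : ℝ) ^ (1 - δ) := Nat.floor_le (by linarith)
  have hf3 : f k δ n ≤ k * n := by
    have : (0 : ℝ) ≤ (n : ℝ) ^ (1 - δ) := by positivity
    have : (f k δ n : ℝ) ≤ ((k * n : ℕ) : ℝ) := by push_cast; linarith
    exact_mod_cast this
  have hr := discarded_cast_le δ n
  have hb := sub_le_singularValues_companion_sq_mul (by omega) hn (Nat.sub_le n (discarded δ n)) z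
    hz C _ _ (by positivity) h (f k δ n - 1) (by omega)
  rw [Nat.cast_sub (discarded_le hδ₀ hδ n), Nat.cast_sub hf1, Nat.cast_one] at hb
  refine le_of_normalized_bound hk hn hδ₀ hδ hε (Complex.normSq_pos.2 hz)
    (LinearMap.singularValues_nonneg _ _) (le_trans ?_ hb)
  linarith

end MonicGaussian

theorem lemmaA5 (k : ℕ) (hk : 2 ≤ k) (δ : ℝ) (hδ₀ : 0 < δ) (hδ : δ < 1 / 2)
    (z : ℂ) (hz : z ≠ 0) :
    ∃ t ε : ℝ, 0 < t ∧ t ≤ 1 ∧ 0 < ε ∧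
      ∀ (Ω : Type u) [MeasurableSpace Ω] (P : Measure Ω) [IsProbabilityMeasure P]
        (C : (n : ℕ) → Fin k → Ω → Matrix (Fin n) (Fin n) ℂ),
        (∀ (n : ℕ) (j : Fin k) (a b : Fin n),
          HasLaw (fun ω => C n j ω a b) MonicGaussian.stdComplexGaussian P) →
        iIndepFun (fun (s : Σ n : ℕ, Fin k × Fin n × Fin n) (ω : Ω) =>
          C s.1 s.2.1 ω s.2.2.1 s.2.2.2) P →
        ∀ᵐ ω ∂P, ∀ᶠ n : ℕ in atTop,
          t * (n : ℝ) ^ (ε - 1 / 2) ≤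
            MonicGaussian.sigma (MonicGaussian.f k δ n)
              ((((n : ℝ) ^ (-(1 / 2) : ℝ) : ℝ) : ℂ) •
                  (MonicGaussian.E₁ k n * MonicGaussian.CT (fun j => C n j ω))
                - z • (1 : Matrix (Fin k × Fin n) (Fin k × Fin n) ℂ)) := by
  have hZ : 0 < Complex.normSq z := Complex.normSq_pos.2 hz
  -- with `T = n ^ ε`, the exponents balance exactly when `2 * ε - 1 = -2 * δ - ε`
  set ε : ℝ := (1 - 2 * δ) / 3 with hε
  have hε0 : 0 < ε := by rw [hε]; linarith
  refine ⟨MonicGaussian.lowerConstant k (Complex.normSq z), ε,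
    MonicGaussian.lowerConstant_pos hk hZ, MonicGaussian.lowerConstant_le_one hk hZ, hε0, ?_⟩
  intro Ω _ P _ C hC hind
  set r := MonicGaussian.discarded δ
  set typical : (n : ℕ) → (Fin k × Fin n → Fin n → ℂ) → Prop := fun n =>
    MonicGaussian.IsTypical (MonicGaussian.leadingColumn (by omega : 0 < k) (Nat.sub_le n (r n)))
      (MonicGaussian.diagonalShift (Nat.sub_le n (r n)) z) (r n + 1) ((n : ℝ) ^ ε)
  have hlaw : ∀ n, HasLaw (fun ω => MonicGaussian.coeffColumns fun j => C n j ω)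
      (MonicGaussian.gaussianColumns (Fin k × Fin n) (Fin n)) P := by
    intro n
    refine MonicGaussian.hasLaw_gaussianColumns
      (fun p : (Fin k × Fin n) × Fin n => fun ω => C n p.1.1 ω p.2 p.1.2) (fun p => hC n _ _ _) ?_
    exact hind.precomp (g := fun p : (Fin k × Fin n) × Fin n => ⟨n, p.1.1, p.2, p.1.2⟩) (by
      rintro ⟨⟨a, b⟩, c⟩ ⟨⟨a', b'⟩, c'⟩ h
      simp only [Sigma.mk.injEq, heq_eq_eq, Prod.mk.injEq, true_and] at h ⊢
      tauto)
  have hprob : ∀ n, P {ω | ¬ typical n (MonicGaussian.coeffColumns fun j => C n j ω)} ≤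
      ENNReal.ofReal (((n - r n : ℕ) : ℝ) * (√(Real.exp 1) / 2) ^ (r n + 1) +
        ((n - r n : ℕ) : ℝ) * ((k * n : ℕ) : ℝ) *
          (4 * Real.exp (1 / 4 - √((n : ℝ) ^ ε / 2)))) := by
    intro n
    refine (Measure.le_map_apply (hlaw n).aemeasurable {x | ¬ typical n x}).trans ?_
    rw [(hlaw n).map_eq]
    refine (MonicGaussian.gaussianColumns_not_isTypical_le _
      (MonicGaussian.leadingColumn_injective _ _) _ (r n + 1) (Nat.succ_pos _) ?_ _
      (by positivity)).trans (le_of_eq ?_)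
    · have : r n ≤ n := MonicGaussian.discarded_le hδ₀ hδ n
      simp only [Fintype.card_fin]
      omega
    · simp only [Fintype.card_fin, Fintype.card_prod]
  have hsum : ∑' n, P {ω | ¬ typical n (MonicGaussian.coeffColumns fun j => C n j ω)} ≠ ⊤ :=
    ne_top_of_le_ne_top
      (MonicGaussian.summable_failure_probability k hδ₀ hδ hε0).tsum_ofReal_ne_top
      (ENNReal.tsum_le_tsum hprob)
  filter_upwards [ae_eventually_notMem hsum] with ω hω
  filter_upwards [hω, eventually_gt_atTop 0] with n hn hn0
  exact MonicGaussian.le_sigma_of_isTypical hk hn0 hδ₀ hδ (by rw [hε]; ring) hz _ (not_not.1 hn)
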